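/- There is a universal constant $C>0$ with the following property. Let $(\Omega,\mathcal A,\mathbb P)$ be a probability space, let $N\ge 0$ and $p\geq 1$ be integers, let $\mathbf G=(\mathcal G_i)_{i=0}^N$ be a filtration, and let $(\xi_i)_{i=1}^N$ be a martingale difference sequence in $\mathbb R^p$ with respect to $\mathbf G$, that is, each $\xi_i=(\xi_{i1},\dots,\xi_{ip})$ is $\mathcal G_i$-measurable and integrable and $\mathbb E[\xi_i\mid\mathcal G_{i-1}]=0$ almost surely. Then, for every real number $m\geq 1$, $$ \Bigl\|\max_{1\le j\le p}\max_{1\le n\le N}\Bigl|\sum_{i=1}^n\xi_{ij}\Bigr|\Bigr\|_{L^m(\mathbb P)} \leq C\Bigl(\Bigl\|\max_{1\le j\le p}\sqrt{\sum_{i=1}^N\mathbb E[\xi_{ij}^2\mid\mathcal G_{i-1}]}\Bigr\|_{L^m(\mathbb P)}\sqrt{m+\log p} +\Bigl\|\max_{1\le i\le N}\|\xi_i\|_\infty\Bigr\|_{L^m(\mathbb P)}(m+\log p)\Bigr). $$ Here $\|x\|_\infty=\max_{1\le j\le p}|x_j|$, the conditional expectations of the nonnegative variables $\xi_{ij}^2$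 are the usual $[0,\infty]$-valued ones, $\|Z\|_{L^m(\mathbb P)}=(\mathbb E[|Z|^m])^{1/m}\in[0,\infty]$, and a maximum over the empty set is $0$. -/

import Mathlib

open MeasureTheory ProbabilityTheory
open scoped ENNReal

/-- A finite martingale difference sequence `ξ_1, …, ξ_N` with respect to a filtration
`G_0 ⊆ G_1 ⊆ … ⊆ G_N` under the measure `μ`: each `ξ_i` is `G_i`-measurable, integrable, and
`E[ξ_i | G_{i-1}] = 0` almost surely. The sequence is indexed by `Fin N`, so that `ξ i` is the
`(i+1)`-st term; `i.succ` and `i.castSucc` are the indices of the σ-algebras `G_{i+1}` and `G_i`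
in the filtration, which is indexed by `Fin (N + 1) = {0, …, N}`. -/
structure IsMartingaleDifferenceSeq {Ω : Type*} {mΩ : MeasurableSpace Ω} {N : ℕ}
    {E : Type*} [NormedAddCommGroup E] [NormedSpace ℝ E] [CompleteSpace E]
    (ξ : Fin N → Ω → E) (G : Filtration (Fin (N + 1)) mΩ) (μ : Measure Ω) : Prop where
  adapted : ∀ i : Fin N, StronglyMeasurable[G i.succ] (ξ i)
  integrable : ∀ i : Fin N, Integrable (ξ i) μ
  condExp_eq_zero : ∀ i : Fin N, μ[ξ i | G i.castSucc] =ᵐ[μ] 0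

/-- `max_{j} max_{n} |∑_{i ≤ n} ξ_{ij}|`, as a `[0, ∞]`-valued function; a maximum over the empty
set is `0`. -/
noncomputable def maxPartialSum {Ω : Type*} {N p : ℕ} (ξ : Fin N → Ω → Fin p → ℝ) (ω : Ω) :
    ℝ≥0∞ :=
  ⨆ (j : Fin p) (n : Fin N), ENNReal.ofReal |∑ i ∈ Finset.Iic n, ξ i ω j|

/-- `max_{j} (∑_{i} E[ξ_{ij}² | G_{i-1}])^{1/2}`, where `E[· | G_{i-1}]` is the conditional
expectation of a `[0, ∞]`-valued random variable, so that `ξ_{ij}` need not be square integrable. -/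
noncomputable def maxCondSD {Ω : Type*} {mΩ : MeasurableSpace Ω} {N p : ℕ}
    (ξ : Fin N → Ω → Fin p → ℝ) (G : Filtration (Fin (N + 1)) mΩ) (μ : Measure Ω) (ω : Ω) :
    ℝ≥0∞ :=
  ⨆ j : Fin p,
    (∑ i : Fin N, condLExp (G i.castSucc) μ (fun ω' => ENNReal.ofReal (ξ i ω' j ^ 2)) ω) ^
      (1 / 2 : ℝ)

/-- `max_{i} ‖ξ_i‖_∞ = max_{i} max_{j} |ξ_{ij}|`. -/
noncomputable def maxIncrement {Ω : Type*} {N p : ℕ} (ξ : Fin N → Ω → Fin p → ℝ) (ω : Ω) :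
    ℝ≥0∞ :=
  ⨆ (i : Fin N) (j : Fin p), ENNReal.ofReal |ξ i ω j|

/-!
The inequality follows from a good-`λ` argument. Write `S`, `V`, `B` for the maximal partial sum,
the maximal conditional standard deviation and the maximal increment, and put `M = m + log p`.

*Exponential supermartingale without boundedness.* For `t b ≤ 1` and every real `u`,
`1_{u ≤ b} exp (t u) ≤ 1 + t u + t² u²`: for `u ≤ b` this is an inequality for the exponential, and
for `u > b` the left side is zero while the right side is nonnegative. Hence a martingale difference
`U`, bounded or not, satisfies `E[1_{U ≤ b} exp (t U) | m] ≤ 1 + t² E[U² | m]`, so the factor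
`truncExpFactor` has conditional expectation at most one (`lintegral_mul_truncExpFactor_le`). The
products of such factors are supermartingales. Restricting to a predictable set of times starts and
stops them, and Markov's inequality yields a maximal inequality relative to the event that the
martingale has been started (`measure_exists_sum_indicator_ge_le`).

*Good-`λ` inequality.* Each coordinate, with either sign, is started at the first time that
`max_j |S_{n,j}|` exceeds `λ`. A union bound over the `2 p` choices gives
`P(S > 3λ, B ≤ b, V² ≤ r) ≤ 2 p exp (-t λ + t² r) P(S > λ)` (`measure_goodLambda_le`). For
`b = λ / (6 M)`, `t = 1 / b` and `r = λ² / (36 M)` the coefficient is `2 p exp (-5 M)`, which is at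
most `3⁻ᵐ / 2` (`goodLambda_const_le`).

*Integration.* Integrating against `m λ^(m-1) dλ` bounds `E[S^m]` by `2 * 3 ^ m` times
`E[(6 √M V + 6 M B)^m]` (`lintegral_rpow_le_of_goodLambda`). Absorbing the term in `E[S^m]` requires
it to be finite, which follows from `S ≤ N B` unless the right side of the claim is infinite.
-/

/-! ### A one-step exponential estimate -/

/-- An inequality between integrals over all `m`-measurable sets extends to `m`-measurable weights:
it says that one measure is at most the other on `m`. -/
theorem lintegral_mul_le_lintegral_mul_of_setLIntegral_le {Ω : Type*} {m mΩ : MeasurableSpace Ω}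
    (hm : m ≤ mΩ) {μ : Measure Ω} {F F' g : Ω → ℝ≥0∞} (hF : Measurable F) (hF' : Measurable F')
    (hg : Measurable[m] g)
    (h : ∀ s, MeasurableSet[m] s → ∫⁻ ω in s, F ω ∂μ ≤ ∫⁻ ω in s, F' ω ∂μ) :
    ∫⁻ ω, g ω * F ω ∂μ ≤ ∫⁻ ω, g ω * F' ω ∂μ := by
  have hle : (μ.withDensity F).trim hm ≤ (μ.withDensity F').trim hm := by
    refine Measure.le_iff.2 fun s hs => ?_
    rw [trim_measurableSet_eq hm hs, trim_measurableSet_eq hm hs, withDensity_apply _ (hm s hs),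
      withDensity_apply _ (hm s hs)]
    exact h s hs
  have key := lintegral_mono' hle (le_refl g)
  rw [lintegral_trim hm hg, lintegral_trim hm hg,
    lintegral_withDensity_eq_lintegral_mul _ hF (hg.mono hm le_rfl),
    lintegral_withDensity_eq_lintegral_mul _ hF' (hg.mono hm le_rfl)] at key
  simpa only [Pi.mul_apply, mul_comm] using key

theorem lintegral_mul_eq_lintegral_mul_of_setLIntegral_eq {Ω : Type*} {m mΩ : MeasurableSpace Ω}
    (hm : m ≤ mΩ) {μ : Measure Ω} {F F' g : Ω → ℝ≥0∞} (hF : Measurable F) (hF' : Measurable F')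
    (hg : Measurable[m] g)
    (h : ∀ s, MeasurableSet[m] s → ∫⁻ ω in s, F ω ∂μ = ∫⁻ ω in s, F' ω ∂μ) :
    ∫⁻ ω, g ω * F ω ∂μ = ∫⁻ ω, g ω * F' ω ∂μ :=
  le_antisymm
    (lintegral_mul_le_lintegral_mul_of_setLIntegral_le hm hF hF' hg fun s hs => (h s hs).le)
    (lintegral_mul_le_lintegral_mul_of_setLIntegral_le hm hF' hF hg fun s hs => (h s hs).ge)

theorem setLIntegral_ofReal_eq_setLIntegral_ofReal_neg {Ω : Type*} {m mΩ : MeasurableSpace Ω}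
    (hm : m ≤ mΩ) {μ : Measure Ω} [IsFiniteMeasure μ] {U : Ω → ℝ} (hU : Integrable U μ)
    (h0 : μ[U | m] =ᵐ[μ] 0) {s : Set Ω} (hs : MeasurableSet[m] s) :
    ∫⁻ ω in s, ENNReal.ofReal (U ω) ∂μ = ∫⁻ ω in s, ENNReal.ofReal (-U ω) ∂μ := by
  have hz : ∫ ω in s, U ω ∂μ = 0 := by
    rw [← setIntegral_condExp hm hU hs]
    rw [integral_congr_ae (ae_restrict_of_ae h0)]
    simp
  have hfin : ∀ {V : Ω → ℝ}, Integrable V μ → ∫⁻ ω in s, ENNReal.ofReal (V ω) ∂μ ≠ ∞ := by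
    intro V hV
    exact (hV.restrict (s := s)).lintegral_lt_top.ne
  rw [integral_eq_lintegral_pos_part_sub_lintegral_neg_part hU.restrict, sub_eq_zero] at hz
  exact (ENNReal.toReal_eq_toReal_iff' (hfin hU) (hfin hU.neg)).1 hz

theorem Real.exp_le_one_add_self_add_sq {x : ℝ} (hx : x ≤ 1) : Real.exp x ≤ 1 + x + x ^ 2 := by
  rcases le_total (-1) x with h | h
  · have := (abs_le.1 (Real.abs_exp_sub_one_sub_id_le (abs_le.2 ⟨h, hx⟩))).2
    linarith
  · have : Real.exp x ≤ 1 := Real.exp_le_one_iff.2 (by linarith)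
    nlinarith

/-- The factor `1_{U ≤ b} exp (t U) / (1 + t² E[U² | m])`, where the conditional expectation takes
values in `[0, ∞]`; the factor vanishes where it is infinite. -/
noncomputable def truncExpFactor {Ω : Type*} (m : MeasurableSpace Ω) {mΩ : MeasurableSpace Ω}
    (μ : Measure Ω) (U : Ω → ℝ) (t b : ℝ) (ω : Ω) : ℝ≥0∞ :=
  (1 + ENNReal.ofReal (t ^ 2) * condLExp m μ (fun ω' => ENNReal.ofReal (U ω' ^ 2)) ω)⁻¹ *
    {ω' | U ω' ≤ b}.indicator (fun ω' => ENNReal.ofReal (Real.exp (t * U ω'))) ω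

theorem measurable_truncExpFactor {Ω : Type*} {m m' mΩ : MeasurableSpace Ω} (hm : m ≤ m')
    (μ : Measure Ω) {U : Ω → ℝ} (hU : Measurable[m'] U) (t b : ℝ) :
    Measurable[m'] (truncExpFactor m μ U t b) := by
  unfold truncExpFactor
  have h1 := (measurable_condLExp m μ (fun ω' => ENNReal.ofReal (U ω' ^ 2))).mono hm le_rfl
  refine ((h1.const_mul _).const_add _).inv.mul (Measurable.indicator ?_ (hU measurableSet_Iic))
  exact (Real.measurable_exp.comp (hU.const_mul t)).ennreal_ofReal

/-- The truncation `U ≤ b` makes the bound hold without any centring correction, because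
`1 + u + u²` is nonnegative also where the truncated exponential vanishes. -/
theorem indicator_exp_add_le {Ω : Type*} (U : Ω → ℝ) {t b : ℝ} (ht : 0 ≤ t) (htb : t * b ≤ 1)
    (ω : Ω) :
    {ω' | U ω' ≤ b}.indicator (fun ω' => ENNReal.ofReal (Real.exp (t * U ω'))) ω +
        ENNReal.ofReal t * ENNReal.ofReal (-U ω) ≤
      1 + ENNReal.ofReal (t ^ 2) * ENNReal.ofReal (U ω ^ 2) +
        ENNReal.ofReal t * ENNReal.ofReal (U ω) := by
  have hexp : {ω' | U ω' ≤ b}.indicator (fun ω' => ENNReal.ofReal (Real.exp (t * U ω'))) ω ≤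
      ENNReal.ofReal (1 + t * U ω + (t * U ω) ^ 2) := by
    by_cases hb : U ω ≤ b
    · rw [Set.indicator_of_mem (by exact hb)]
      refine ENNReal.ofReal_le_ofReal (Real.exp_le_one_add_self_add_sq ?_)
      exact (mul_le_mul_of_nonneg_left hb ht).trans htb
    · rw [Set.indicator_of_notMem (by exact hb)]
      exact zero_le
  refine (add_le_add_left hexp _).trans ?_
  have hpos : 0 ≤ 1 + t * U ω + (t * U ω) ^ 2 := by nlinarith [sq_nonneg (t * U ω + 1)]
  rw [← ENNReal.ofReal_mul ht, ← ENNReal.ofReal_mul ht, ← ENNReal.ofReal_mul (sq_nonneg t),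
    ← ENNReal.ofReal_one, ← ENNReal.ofReal_add zero_le_one (by positivity)]
  rcases le_total 0 (U ω) with h | h
  · rw [ENNReal.ofReal_of_nonpos (p := t * -U ω) (by nlinarith), add_zero,
      ← ENNReal.ofReal_add (by positivity) (by positivity)]
    exact ENNReal.ofReal_le_ofReal (by nlinarith)
  · rw [ENNReal.ofReal_of_nonpos (p := t * U ω) (by nlinarith), add_zero,
      ← ENNReal.ofReal_add hpos (by nlinarith)]
    exact ENNReal.ofReal_le_ofReal (by nlinarith)

/-- Conditionally on `m`, the truncated exponential factor has expectation at most one. -/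
theorem lintegral_mul_truncExpFactor_le {Ω : Type*} {m mΩ : MeasurableSpace Ω} (hm : m ≤ mΩ)
    {μ : Measure Ω} [IsFiniteMeasure μ] {U : Ω → ℝ} (hUm : Measurable U) (hU : Integrable U μ)
    (h0 : μ[U | m] =ᵐ[μ] 0) {t b : ℝ} (ht : 0 ≤ t) (htb : t * b ≤ 1) {g : Ω → ℝ≥0∞}
    (hg : Measurable[m] g) :
    ∫⁻ ω, g ω * truncExpFactor m μ U t b ω ∂μ ≤ ∫⁻ ω, g ω ∂μ := by
  suffices H : ∀ s, MeasurableSet[m] s →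
      ∫⁻ ω in s, truncExpFactor m μ U t b ω ∂μ ≤ ∫⁻ ω in s, 1 ∂μ by
    simpa using lintegral_mul_le_lintegral_mul_of_setLIntegral_le hm
      (measurable_truncExpFactor hm μ hUm t b) (measurable_const (a := (1 : ℝ≥0∞))) hg H
  intro s hs
  set q := condLExp m μ (fun ω' => ENNReal.ofReal (U ω' ^ 2)) with hq
  set e : Ω → ℝ≥0∞ :=
    {ω' | U ω' ≤ b}.indicator (fun ω' => ENNReal.ofReal (Real.exp (t * U ω'))) with he
  have hqm : Measurable[m] q := measurable_condLExp _ _ _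
  set h : Ω → ℝ≥0∞ := s.indicator (fun ω => (1 + ENNReal.ofReal (t ^ 2) * q ω)⁻¹) with hh
  have hhm : Measurable[m] h := ((hqm.const_mul _).const_add _).inv.indicator hs
  have hhm' : Measurable h := hhm.mono hm le_rfl
  have hh1 : ∀ ω, h ω ≤ 1 := by
    intro ω
    refine Set.indicator_le_self' (fun _ _ => zero_le) ω |>.trans ?_
    exact ENNReal.inv_le_one.2 le_self_add
  have hem : Measurable e :=
    (Real.measurable_exp.comp (hUm.const_mul t)).ennreal_ofReal.indicator (hUm measurableSet_Iic)
  have hme : Measurable fun ω => h ω * e ω := hhm'.mul hem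
  have hmPos : Measurable fun ω => h ω * ENNReal.ofReal (U ω) := hhm'.mul hUm.ennreal_ofReal
  have hmNeg : Measurable fun ω => h ω * ENNReal.ofReal (-U ω) := hhm'.mul hUm.neg.ennreal_ofReal
  have hmSq : Measurable fun ω => h ω * ENNReal.ofReal (U ω ^ 2) :=
    hhm'.mul (hUm.pow_const 2).ennreal_ofReal
  have hmq : Measurable fun ω => h ω * q ω := hhm'.mul (hqm.mono hm le_rfl)
  have hPos : ∫⁻ ω, h ω * ENNReal.ofReal (U ω) ∂μ = ∫⁻ ω, h ω * ENNReal.ofReal (-U ω) ∂μ :=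
    lintegral_mul_eq_lintegral_mul_of_setLIntegral_eq hm hUm.ennreal_ofReal
      hUm.neg.ennreal_ofReal hhm fun s hs =>
        setLIntegral_ofReal_eq_setLIntegral_ofReal_neg hm hU h0 hs
  have hSq : ∫⁻ ω, h ω * ENNReal.ofReal (U ω ^ 2) ∂μ = ∫⁻ ω, h ω * q ω ∂μ :=
    lintegral_mul_eq_lintegral_mul_of_setLIntegral_eq hm (hUm.pow_const 2).ennreal_ofReal
      (hqm.mono hm le_rfl) hhm fun s hs => (setLIntegral_condLExp hm μ _ hs).symm
  have hfin : ENNReal.ofReal t * ∫⁻ ω, h ω * ENNReal.ofReal (-U ω) ∂μ ≠ ∞ := by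
    refine ENNReal.mul_ne_top ENNReal.ofReal_ne_top (ne_top_of_le_ne_top hU.neg.lintegral_lt_top.ne
      (lintegral_mono fun ω => ?_))
    exact (mul_le_mul_left (hh1 ω) _).trans (one_mul _).le
  have hfac : ∫⁻ ω in s, truncExpFactor m μ U t b ω ∂μ = ∫⁻ ω, h ω * e ω ∂μ := by
    rw [← lintegral_indicator (hm s hs)]
    refine lintegral_congr fun ω => ?_
    by_cases hω : ω ∈ s
    · simp [hh, hω, truncExpFactor, hq, he]
    · simp [hh, hω]
  rw [hfac]
  -- Adding `t ∫ h U⁻` on both sides keeps all integrands nonnegative; it cancels since `∫ h U = 0`.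
  refine (ENNReal.add_le_add_iff_right hfin).1 ?_
  calc ∫⁻ ω, h ω * e ω ∂μ + ENNReal.ofReal t * ∫⁻ ω, h ω * ENNReal.ofReal (-U ω) ∂μ
      = ∫⁻ ω, h ω * (e ω + ENNReal.ofReal t * ENNReal.ofReal (-U ω)) ∂μ := by
        rw [← lintegral_const_mul _ hmNeg, ← lintegral_add_left hme]
        exact lintegral_congr fun ω => by ring
    _ ≤ ∫⁻ ω, h ω * (1 + ENNReal.ofReal (t ^ 2) * ENNReal.ofReal (U ω ^ 2) +
          ENNReal.ofReal t * ENNReal.ofReal (U ω)) ∂μ :=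
        lintegral_mono fun ω => mul_le_mul_right (indicator_exp_add_le U ht htb ω) _
    _ = ∫⁻ ω, h ω ∂μ + ENNReal.ofReal (t ^ 2) * ∫⁻ ω, h ω * ENNReal.ofReal (U ω ^ 2) ∂μ +
          ENNReal.ofReal t * ∫⁻ ω, h ω * ENNReal.ofReal (U ω) ∂μ := by
        rw [← lintegral_const_mul _ hmSq, ← lintegral_const_mul _ hmPos,
          ← lintegral_add_left hhm', ← lintegral_add_right _ (hmPos.const_mul _)]
        exact lintegral_congr fun ω => by ring
    _ = ∫⁻ ω, h ω * (1 + ENNReal.ofReal (t ^ 2) * q ω) ∂μ +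
          ENNReal.ofReal t * ∫⁻ ω, h ω * ENNReal.ofReal (-U ω) ∂μ := by
        rw [hSq, hPos, ← lintegral_const_mul _ hmq, ← lintegral_add_left hhm']
        congr 1
        exact lintegral_congr fun ω => by ring
    _ ≤ ∫⁻ ω in s, 1 ∂μ + ENNReal.ofReal t * ∫⁻ ω, h ω * ENNReal.ofReal (-U ω) ∂μ := by
        refine add_le_add_left ?_ _
        rw [← lintegral_indicator (hm s hs)]
        refine lintegral_mono fun ω => ?_
        by_cases hω : ω ∈ s
        · simp [hh, hω]
        · simp [hh, hω]

/-! ### Maximal inequality for started martingales -/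

open scoped Classical in
/-- The product of the truncated exponential factors over the predictable set of times
`{i < n | ω ∈ P i}`. -/
noncomputable def truncExpProd {Ω : Type*} {mΩ : MeasurableSpace Ω} (𝒢 : Filtration ℕ mΩ)
    (μ : Measure Ω) (U : ℕ → Ω → ℝ) (t b : ℝ) (P : ℕ → Set Ω) (n : ℕ) (ω : Ω) : ℝ≥0∞ :=
  ∏ i ∈ Finset.range n, if ω ∈ P i then truncExpFactor (𝒢 i) μ (U i) t b ω else 1

theorem measurable_truncExpProd {Ω : Type*} {mΩ : MeasurableSpace Ω} {𝒢 : Filtration ℕ mΩ}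
    {μ : Measure Ω} {U : ℕ → Ω → ℝ} (hU : ∀ i, Measurable[𝒢 (i + 1)] (U i)) (t b : ℝ)
    {P : ℕ → Set Ω} (hP : ∀ i, MeasurableSet[𝒢 i] (P i)) (n : ℕ) :
    Measurable[𝒢 n] (truncExpProd 𝒢 μ U t b P n) := by
  unfold truncExpProd
  refine Finset.measurable_fun_prod _ fun i hi => ?_
  have hin : i + 1 ≤ n := Finset.mem_range.1 hi
  refine Measurable.ite (𝒢.mono (Nat.le_of_succ_le hin) _ (hP i)) ?_ measurable_const
  exact (measurable_truncExpFactor (𝒢.mono i.le_succ) μ (hU i) t b).mono (𝒢.mono hin) le_rfl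

/-- Supermartingale bound for the product, localized to an event `A` outside which no factor is
active; `A` itself need not belong to any `𝒢 i`. -/
theorem setLIntegral_truncExpProd_le {Ω : Type*} {mΩ : MeasurableSpace Ω} {𝒢 : Filtration ℕ mΩ}
    {μ : Measure Ω} [IsFiniteMeasure μ] {U : ℕ → Ω → ℝ}
    (hU : ∀ i, Measurable[𝒢 (i + 1)] (U i)) (hUi : ∀ i, Integrable (U i) μ)
    (h0 : ∀ i, μ[U i | 𝒢 i] =ᵐ[μ] 0) {t b : ℝ} (ht : 0 ≤ t) (htb : t * b ≤ 1)
    {P : ℕ → Set Ω} (hP : ∀ i, MeasurableSet[𝒢 i] (P i)) {A : Set Ω} (hA : MeasurableSet A)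
    (n : ℕ) (hPA : ∀ i < n, P i ⊆ A) :
    ∫⁻ ω in A, truncExpProd 𝒢 μ U t b P n ω ∂μ ≤ μ A := by
  induction n with
  | zero => simp [truncExpProd]
  | succ n ih =>
    refine le_trans ?_ (ih fun i hi => hPA i (hi.trans n.lt_succ_self))
    set R := truncExpProd 𝒢 μ U t b P n with hR
    have hPn : MeasurableSet (P n) := 𝒢.le n _ (hP n)
    have hRn : Measurable[𝒢 n] R := measurable_truncExpProd hU t b hP n
    have hsub : A ∩ P n = P n := Set.inter_eq_right.2 (hPA n n.lt_succ_self)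
    rw [← lintegral_inter_add_sdiff _ A hPn, ← lintegral_inter_add_sdiff R A hPn, hsub]
    refine add_le_add ?_ (le_of_eq ?_)
    · have key := lintegral_mul_truncExpFactor_le (𝒢.le n) ((hU n).mono (𝒢.le _) le_rfl) (hUi n)
        (h0 n) ht htb (hRn.indicator (hP n))
      rw [lintegral_indicator hPn] at key
      refine le_trans (le_of_eq ?_) key
      rw [← lintegral_indicator hPn]
      refine lintegral_congr fun ω => ?_
      by_cases hω : ω ∈ P n
      · simp [hω, hR, truncExpProd, Finset.prod_range_succ]
      · simp [hω]
    · refine setLIntegral_congr_fun (hA.diff hPn) fun ω hω => ?_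
      simp [hR, truncExpProd, Finset.prod_range_succ, hω.2]

theorem ENNReal.prod_one_add_ofReal_le {ι : Type*} (s : Finset ι) (q : ι → ℝ≥0∞) {a r : ℝ}
    (ha : 0 ≤ a) (hr : 0 ≤ r) (hq : ∑ i ∈ s, q i ≤ ENNReal.ofReal r) :
    ∏ i ∈ s, (1 + ENNReal.ofReal a * q i) ≤ ENNReal.ofReal (Real.exp (a * r)) := by
  have hsum : ∑ i ∈ s, q i ≠ ∞ := (hq.trans_lt ENNReal.ofReal_lt_top).ne
  have hfin : ∀ i ∈ s, q i ≠ ∞ := ENNReal.sum_ne_top.1 hsum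
  calc ∏ i ∈ s, (1 + ENNReal.ofReal a * q i)
      ≤ ∏ i ∈ s, ENNReal.ofReal (Real.exp (a * (q i).toReal)) := by
        refine Finset.prod_le_prod' fun i hi => ?_
        rw [← ENNReal.ofReal_toReal (hfin i hi), ENNReal.toReal_ofReal ENNReal.toReal_nonneg,
          ← ENNReal.ofReal_mul ha, ← ENNReal.ofReal_one,
          ← ENNReal.ofReal_add zero_le_one (by positivity), add_comm]
        exact ENNReal.ofReal_le_ofReal (Real.add_one_le_exp _)
    _ = ENNReal.ofReal (Real.exp (a * (∑ i ∈ s, q i).toReal)) := by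
        rw [← ENNReal.ofReal_prod_of_nonneg fun i _ => (Real.exp_pos _).le, ← Real.exp_sum,
          ← Finset.mul_sum, ENNReal.toReal_sum hfin]
    _ ≤ ENNReal.ofReal (Real.exp (a * r)) :=
        ENNReal.ofReal_le_ofReal (Real.exp_le_exp.2
          (mul_le_mul_of_nonneg_left (ENNReal.toReal_le_of_le_ofReal hr hq) ha))

/-- Maximal exponential inequality for the martingale `∑ 1_{A i} U i`, which stays at zero outside
`B`. The factor `μ B` on the right is what the good-`λ` inequality rests on. -/
theorem measure_exists_sum_indicator_ge_le {Ω : Type*} {mΩ : MeasurableSpace Ω}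
    {𝒢 : Filtration ℕ mΩ} {μ : Measure Ω} [IsFiniteMeasure μ] {U : ℕ → Ω → ℝ}
    (hU : ∀ i, Measurable[𝒢 (i + 1)] (U i)) (hUi : ∀ i, Integrable (U i) μ)
    (h0 : ∀ i, μ[U i | 𝒢 i] =ᵐ[μ] 0) {t b x r : ℝ} (ht : 0 ≤ t) (htb : t * b ≤ 1) (hr : 0 ≤ r)
    {A : ℕ → Set Ω} (hA : ∀ i, MeasurableSet[𝒢 i] (A i)) {B : Set Ω} (hB : MeasurableSet B)
    (N : ℕ) (hAB : ∀ i < N, A i ⊆ B) :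
    μ {ω | ω ∈ B ∧ (∃ n ≤ N, x ≤ ∑ i ∈ Finset.range n, (A i).indicator (U i) ω) ∧
        (∀ i < N, U i ω ≤ b) ∧
        ∑ i ∈ Finset.range N, condLExp (𝒢 i) μ (fun ω' => ENNReal.ofReal (U i ω' ^ 2)) ω ≤
          ENNReal.ofReal r} ≤
      ENNReal.ofReal (Real.exp (-t * x + t ^ 2 * r)) * μ B := by
  set T : ℕ → Ω → ℝ := fun n ω => ∑ i ∈ Finset.range n, (A i).indicator (U i) ω with hT
  have hTm : ∀ n, Measurable[𝒢 n] (T n) := fun n =>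
    Finset.measurable_fun_sum _ fun i hi =>
      (((hU i).indicator (𝒢.mono i.le_succ _ (hA i))).mono (𝒢.mono (Finset.mem_range.1 hi)) le_rfl)
  -- Stopping at the first time the sum reaches `x` turns the maximum into a terminal value.
  set P : ℕ → Set Ω := fun n => A n ∩ ⋂ k ∈ Finset.range (n + 1), {ω | T k ω < x} with hPdef
  have hP : ∀ n, MeasurableSet[𝒢 n] (P n) := by
    intro n
    refine (hA n).inter (Finset.measurableSet_biInter _ fun k hk => ?_)
    exact (hTm k).mono (𝒢.mono (Nat.lt_succ_iff.1 (Finset.mem_range.1 hk))) le_rfl measurableSet_Iio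
  have hPB : ∀ i < N, P i ⊆ B := fun i hi => Set.inter_subset_left.trans (hAB i hi)
  set R := truncExpProd 𝒢 μ U t b P N with hR
  have hRm : Measurable R := (measurable_truncExpProd hU t b hP N).mono (𝒢.le N) le_rfl
  set c := ENNReal.ofReal (Real.exp (t * x - t ^ 2 * r)) with hc
  have hsub : ∀ ω, (∃ n ≤ N, x ≤ T n ω) → (∀ i < N, U i ω ≤ b) →
      ∑ i ∈ Finset.range N, condLExp (𝒢 i) μ (fun ω' => ENNReal.ofReal (U i ω' ^ 2)) ω ≤
          ENNReal.ofReal r → c ≤ R ω := by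
    classical
    intro ω hex hb hq
    obtain ⟨n, ⟨hnN, hxn⟩, hmin⟩ : ∃ n, (n ≤ N ∧ x ≤ T n ω) ∧ ∀ k < n, ¬ (k ≤ N ∧ x ≤ T k ω) :=
      ⟨Nat.find hex, Nat.find_spec hex, fun k hk => Nat.find_min hex hk⟩
    have hPlt : ∀ i < n, (ω ∈ P i ↔ ω ∈ A i) := by
      intro i hi
      refine ⟨fun h => h.1, fun h => ⟨h, ?_⟩⟩
      simp only [Set.mem_iInter, Finset.mem_range, Set.mem_ofPred_eq]
      intro k hk
      by_contra hcon
      exact hmin k (by omega) ⟨by omega, not_lt.1 hcon⟩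
    have hPge : ∀ i, n ≤ i → ω ∉ P i := by
      intro i hi h
      have := h.2
      simp only [Set.mem_iInter, Finset.mem_range, Set.mem_ofPred_eq] at this
      exact absurd (this n (by omega)) (not_lt.2 hxn)
    set q : ℕ → ℝ≥0∞ := fun i => condLExp (𝒢 i) μ (fun ω' => ENNReal.ofReal (U i ω' ^ 2)) ω
    have hprod : R ω = ∏ i ∈ Finset.range n,
        if ω ∈ A i then truncExpFactor (𝒢 i) μ (U i) t b ω else 1 := by
      rw [hR, truncExpProd, ← Finset.prod_range_mul_prod_Ico _ hnN,
        Finset.prod_eq_one (s := Finset.Ico n N), mul_one]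
      · exact Finset.prod_congr rfl fun i hi => by simp only [hPlt i (Finset.mem_range.1 hi)]
      · intro i hi
        exact if_neg (hPge i (Finset.mem_Ico.1 hi).1)
    have hfac : ∀ i ∈ Finset.range n,
        ENNReal.ofReal (Real.exp (t * (A i).indicator (U i) ω)) *
          (1 + ENNReal.ofReal (t ^ 2) * q i)⁻¹ ≤
        if ω ∈ A i then truncExpFactor (𝒢 i) μ (U i) t b ω else 1 := by
      intro i hi
      split_ifs with h
      · rw [truncExpFactor, Set.indicator_of_mem (show ω ∈ {ω' | U i ω' ≤ b} from
          hb i ((Finset.mem_range.1 hi).trans_le hnN)), Set.indicator_of_mem h, mul_comm]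
      · rw [Set.indicator_of_notMem h]
        simp
    rw [hprod]
    refine le_trans ?_ (Finset.prod_le_prod' hfac)
    rw [Finset.prod_mul_distrib, ← ENNReal.ofReal_prod_of_nonneg fun i _ => (Real.exp_pos _).le,
      ← Real.exp_sum, ← Finset.mul_sum]
    have hV : ∏ i ∈ Finset.range n, (1 + ENNReal.ofReal (t ^ 2) * q i) ≤
        ENNReal.ofReal (Real.exp (t ^ 2 * r)) := by
      refine ENNReal.prod_one_add_ofReal_le _ q (sq_nonneg t) hr (le_trans ?_ hq)
      exact Finset.sum_le_sum_of_subset (Finset.range_mono hnN)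
    have hinv : (ENNReal.ofReal (Real.exp (t ^ 2 * r)))⁻¹ ≤
        ∏ i ∈ Finset.range n, (1 + ENNReal.ofReal (t ^ 2) * q i)⁻¹ := by
      rw [← ENNReal.prod_inv_distrib]
      · exact ENNReal.inv_le_inv.2 hV
      · exact fun i _ j _ _ => Or.inl (by simp)
    rw [hc, sub_eq_add_neg, Real.exp_add, ENNReal.ofReal_mul (Real.exp_pos _).le, Real.exp_neg,
      ENNReal.ofReal_inv_of_pos (Real.exp_pos _)]
    refine mul_le_mul' (ENNReal.ofReal_le_ofReal (Real.exp_le_exp.2 ?_)) hinv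
    exact mul_le_mul_of_nonneg_left hxn ht
  have hmark : c * μ.restrict B {ω | c ≤ R ω} ≤ μ B :=
    (mul_meas_ge_le_lintegral hRm c).trans
      (setLIntegral_truncExpProd_le hU hUi h0 ht htb hP hB N hPB)
  have hcinv : ENNReal.ofReal (Real.exp (-t * x + t ^ 2 * r)) = c⁻¹ := by
    rw [hc, ← ENNReal.ofReal_inv_of_pos (Real.exp_pos _), ← Real.exp_neg]
    congr 2
    ring
  rw [Measure.restrict_apply (measurableSet_le measurable_const hRm)] at hmark
  refine le_trans (measure_mono (t := {ω | c ≤ R ω} ∩ B) ?_) ?_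
  · rintro ω ⟨h1, h2, h3, h4⟩
    exact ⟨hsub ω h2 h3 h4, h1⟩
  · rw [hcinv, mul_comm, ← div_eq_mul_inv]
    rw [ENNReal.le_div_iff_mul_le (Or.inl (by simp [hc, Real.exp_pos])) (Or.inl (by simp [hc]))]
    rwa [mul_comm]

/-! ### The good-`λ` inequality and its integration -/

/-- If `D n` is the part of the partial sum `S n` gathered before the first time `|S|` exceeds `l`,
then `D n` exceeds `l` by at most one increment. -/
theorem abs_sub_sum_indicator_le {Ω : Type*} {X : ℕ → Ω → ℝ} {A : ℕ → Set Ω} {l b : ℝ} {ω : Ω}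
    {N : ℕ} (hl : 0 ≤ l) (hA : ∀ i < N, ω ∉ A i → |∑ k ∈ Finset.range i, X k ω| ≤ l)
    (hmono : ∀ i < N, ∀ k ≤ i, ω ∈ A k → ω ∈ A i) (hb : ∀ i < N, |X i ω| ≤ b) (hb0 : 0 ≤ b) :
    ∀ n ≤ N, |∑ i ∈ Finset.range n, X i ω - ∑ i ∈ Finset.range n, (A i).indicator (X i) ω| ≤
      l + b := by
  intro n
  induction n with
  | zero => intro _; simpa using add_nonneg hl hb0
  | succ n ih =>
    intro hn
    rw [Finset.sum_range_succ, Finset.sum_range_succ]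
    by_cases h : ω ∈ A n
    · rw [Set.indicator_of_mem h, add_sub_add_right_eq_sub]
      exact ih (by omega)
    · have hz : ∑ i ∈ Finset.range n, (A i).indicator (X i) ω = 0 :=
        Finset.sum_eq_zero fun i hi => Set.indicator_of_notMem
          (fun hi' => h (hmono n hn i (Finset.mem_range.1 hi).le hi')) _
      rw [Set.indicator_of_notMem h, hz, add_zero, sub_zero]
      exact (abs_add_le _ _).trans (add_le_add (hA n hn h) (hb n hn))

/-- The good-`λ` inequality for the coordinatewise maximum of a vector martingale. -/
theorem measure_goodLambda_le {Ω : Type*} {mΩ : MeasurableSpace Ω}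
    {𝒢 : Filtration ℕ mΩ} {μ : Measure Ω} [IsFiniteMeasure μ] {p : ℕ} {X : ℕ → Ω → Fin p → ℝ}
    (hX : ∀ i j, Measurable[𝒢 (i + 1)] fun ω => X i ω j)
    (hXi : ∀ i j, Integrable (fun ω => X i ω j) μ)
    (h0 : ∀ i j, μ[fun ω => X i ω j | 𝒢 i] =ᵐ[μ] 0) {t b l r : ℝ} (ht : 0 ≤ t) (htb : t * b ≤ 1)
    (hb0 : 0 ≤ b) (hbl : b ≤ l) (hr : 0 ≤ r) (N : ℕ) :
    μ {ω | (∃ n ≤ N, ∃ j, 3 * l < |∑ i ∈ Finset.range n, X i ω j|) ∧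
        (∀ i < N, ∀ j, |X i ω j| ≤ b) ∧
        ∀ j, ∑ i ∈ Finset.range N,
          condLExp (𝒢 i) μ (fun ω' => ENNReal.ofReal (X i ω' j ^ 2)) ω ≤ ENNReal.ofReal r} ≤
      2 * p * ENNReal.ofReal (Real.exp (-t * l + t ^ 2 * r)) *
        μ {ω | ∃ n ≤ N, ∃ j, l < |∑ i ∈ Finset.range n, X i ω j|} := by
  set A : ℕ → Set Ω := fun n => {ω | ∃ k ≤ n, ∃ j, l < |∑ i ∈ Finset.range k, X i ω j|} with hAdef
  have hl : 0 ≤ l := hb0.trans hbl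
  have hA : ∀ n, MeasurableSet[𝒢 n] (A n) := by
    intro n
    have : A n = ⋃ k ∈ Finset.range (n + 1), ⋃ j, {ω | l < |∑ i ∈ Finset.range k, X i ω j|} := by
      ext ω
      simp [hAdef]
    rw [this]
    refine Finset.measurableSet_biUnion _ fun k hk => MeasurableSet.iUnion fun j => ?_
    have hS : Measurable[𝒢 n] fun ω => ∑ i ∈ Finset.range k, X i ω j :=
      Finset.measurable_fun_sum _ fun i hi => (hX i j).mono (𝒢.mono (by
        have := Finset.mem_range.1 hk
        have := Finset.mem_range.1 hi
        omega)) le_rfl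
    exact (measurable_norm.comp hS) measurableSet_Ioi
  have hmono : ∀ i k, k ≤ i → A k ⊆ A i := fun i k hki ω ⟨n, hn, h⟩ => ⟨n, hn.trans hki, h⟩
  -- The two signs `s` reduce the absolute values to one-sided deviations.
  set F : Fin p × Bool → Set Ω := fun c => {ω | ω ∈ A N ∧
      (∃ n ≤ N, l ≤ ∑ i ∈ Finset.range n,
        (A i).indicator (fun ω => (if c.2 then 1 else -1) * X i ω c.1) ω) ∧
      (∀ i < N, (if c.2 then 1 else -1) * X i ω c.1 ≤ b) ∧
      ∑ i ∈ Finset.range N, condLExp (𝒢 i) μ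
        (fun ω' => ENNReal.ofReal (((if c.2 then 1 else -1) * X i ω' c.1) ^ 2)) ω ≤
          ENNReal.ofReal r} with hF
  have hFle : ∀ c, μ (F c) ≤ ENNReal.ofReal (Real.exp (-t * l + t ^ 2 * r)) * μ (A N) := by
    intro c
    refine measure_exists_sum_indicator_ge_le
      (U := fun i ω => (if c.2 then 1 else -1) * X i ω c.1) (fun i => (hX i c.1).const_mul _)
      (fun i => (hXi i c.1).const_mul _) (fun i => ?_) ht htb hr hA (𝒢.le N _ (hA N)) N
      (fun i hi => hmono N i hi.le)
    have h1 := condExp_smul (μ := μ) (if c.2 then (1 : ℝ) else -1) (fun ω => X i ω c.1) (𝒢 i)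
    filter_upwards [h1, h0 i c.1] with ω hω hω0
    have : (fun ω => (if c.2 then (1 : ℝ) else -1) * X i ω c.1) =
      (if c.2 then (1 : ℝ) else -1) • fun ω => X i ω c.1 := rfl
    rw [this, hω, Pi.smul_apply, hω0]
    simp
  have hsub : {ω | (∃ n ≤ N, ∃ j, 3 * l < |∑ i ∈ Finset.range n, X i ω j|) ∧
        (∀ i < N, ∀ j, |X i ω j| ≤ b) ∧
        ∀ j, ∑ i ∈ Finset.range N,
          condLExp (𝒢 i) μ (fun ω' => ENNReal.ofReal (X i ω' j ^ 2)) ω ≤ ENNReal.ofReal r} ⊆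
      ⋃ c, F c := by
    rintro ω ⟨⟨n, hn, j, hnj⟩, hb, hq⟩
    have hD := abs_sub_sum_indicator_le (X := fun i ω => X i ω j) (A := A) (ω := ω) (N := N) hl
      (fun i _ hi => not_lt.1 fun hlt => hi ⟨i, le_rfl, j, hlt⟩)
      (fun i _ k hk h => hmono i k hk h) (fun i hi => hb i hi j) hb0 n hn
    have hAN : ω ∈ A N := ⟨n, hn, j, by linarith⟩
    set T := ∑ i ∈ Finset.range n, (A i).indicator (fun ω => X i ω j) ω with hT
    have hTl : l ≤ |T| := by
      have := abs_sub_abs_le_abs_sub (∑ i ∈ Finset.range n, X i ω j) T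
      linarith
    rw [Set.mem_iUnion]
    rcases le_abs.1 hTl with h | h
    · refine ⟨(j, true), hAN, ⟨n, hn, ?_⟩, fun i hi => ?_, ?_⟩
      · simpa [hT] using h
      · simpa using (le_abs_self _).trans (hb i hi j)
      · simpa using hq j
    · refine ⟨(j, false), hAN, ⟨n, hn, ?_⟩, fun i hi => ?_, ?_⟩
      · refine h.trans (le_of_eq ?_)
        rw [hT, ← Finset.sum_neg_distrib]
        refine Finset.sum_congr rfl fun i _ => ?_
        by_cases hi : ω ∈ A i <;> simp [hi]
      · simpa using (neg_le_abs _).trans (hb i hi j)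
      · simpa using hq j
  calc _ ≤ μ (⋃ c, F c) := measure_mono hsub
    _ ≤ ∑ c, μ (F c) := measure_iUnion_fintype_le _ _
    _ ≤ ∑ c : Fin p × Bool, ENNReal.ofReal (Real.exp (-t * l + t ^ 2 * r)) * μ (A N) :=
        Finset.sum_le_sum fun c _ => hFle c
    _ = _ := by
        rw [Finset.sum_const, Finset.card_univ, Fintype.card_prod, Fintype.card_fin,
          Fintype.card_bool, nsmul_eq_mul]
        push_cast
        ring

/-- The layer cake formula for functions with values in `[0, ∞]`. -/
theorem lintegral_rpow_eq_lintegral_meas_lt {Ω : Type*} {mΩ : MeasurableSpace Ω} {μ : Measure Ω}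
    {f : Ω → ℝ≥0∞} (hf : Measurable f) {m : ℝ} (hm : 0 < m) (hfin : ∫⁻ ω, f ω ^ m ∂μ ≠ ∞) :
    ∫⁻ ω, f ω ^ m ∂μ = ENNReal.ofReal m *
      ∫⁻ t in Set.Ioi (0 : ℝ), μ {ω | ENNReal.ofReal t < f ω} * ENNReal.ofReal (t ^ (m - 1)) := by
  have hae : ∀ᵐ ω ∂μ, f ω ≠ ∞ := by
    filter_upwards [ae_lt_top (hf.pow_const m) hfin] with ω hω h
    simp [h, ENNReal.top_rpow_of_pos hm] at hω
  have h1 := lintegral_rpow_eq_lintegral_meas_lt_mul μ (f := fun ω => (f ω).toReal)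
    (ae_of_all _ fun _ => ENNReal.toReal_nonneg) hf.ennreal_toReal.aemeasurable hm
  have h2 : ∫⁻ ω, f ω ^ m ∂μ = ∫⁻ ω, ENNReal.ofReal ((f ω).toReal ^ m) ∂μ := by
    refine lintegral_congr_ae ?_
    filter_upwards [hae] with ω hω
    rw [← ENNReal.ofReal_rpow_of_nonneg ENNReal.toReal_nonneg hm.le, ENNReal.ofReal_toReal hω]
  rw [h2, h1]
  congr 1
  refine setLIntegral_congr_fun measurableSet_Ioi fun t ht => ?_
  congr 1
  refine measure_congr ?_
  filter_upwards [hae] with ω hω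
  exact propext (ENNReal.ofReal_lt_iff_lt_toReal (le_of_lt ht) hω).symm

/-- A good-`λ` inequality whose coefficient is at most `3⁻ᵐ / 2` bounds the `m`-th moment of `S`,
provided that it is finite, by that of `W`. -/
theorem lintegral_rpow_le_of_goodLambda {Ω : Type*} {mΩ : MeasurableSpace Ω} {μ : Measure Ω}
    {S W : Ω → ℝ≥0∞} (hS : Measurable S) (hW : Measurable W) {m : ℝ} (hm : 0 < m) {c : ℝ≥0∞}
    (hc : 2 * (3 ^ m * c) ≤ 1) (hfin : ∫⁻ ω, S ω ^ m ∂μ ≠ ∞)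
    (h : ∀ l : ℝ, 0 < l → μ {ω | ENNReal.ofReal (3 * l) < S ω ∧ W ω ≤ ENNReal.ofReal l} ≤
      c * μ {ω | ENNReal.ofReal l < S ω}) :
    ∫⁻ ω, S ω ^ m ∂μ ≤ 2 * 3 ^ m * ∫⁻ ω, W ω ^ m ∂μ := by
  by_cases hWfin : ∫⁻ ω, W ω ^ m ∂μ = ∞
  · rw [hWfin, ENNReal.mul_top (by positivity)]
    exact le_top
  set I := ∫⁻ ω, S ω ^ m ∂μ with hI
  set J := ∫⁻ ω, W ω ^ m ∂μ with hJ
  -- The tail of `S / 3` at `l` is the tail of `S` at `3 l`.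
  have h3 : ∫⁻ ω, (S ω / 3) ^ m ∂μ = (3 ^ m)⁻¹ * I := by
    rw [hI, ← lintegral_const_mul _ (hS.pow_const m)]
    refine lintegral_congr fun ω => ?_
    rw [ENNReal.div_rpow_of_nonneg _ _ hm.le, div_eq_mul_inv, mul_comm]
  have h30 : (3 : ℝ≥0∞) ^ m ≠ 0 := by simp
  have h3t : (3 : ℝ≥0∞) ^ m ≠ ∞ := ENNReal.rpow_ne_top_of_nonneg hm.le (by simp)
  have hg : ∀ f : Ω → ℝ≥0∞, Measurable fun t : ℝ =>
      μ {ω | ENNReal.ofReal t < f ω} * ENNReal.ofReal (t ^ (m - 1)) := by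
    intro f
    refine Measurable.mul (Antitone.measurable fun s t hst => measure_mono fun ω hω => ?_)
      (Measurable.ennreal_ofReal (by fun_prop))
    exact (ENNReal.ofReal_le_ofReal hst).trans_lt hω
  have key : (3 ^ m)⁻¹ * I ≤ c * I + J := by
    rw [← h3, lintegral_rpow_eq_lintegral_meas_lt (hS.div_const 3) hm
        (h3 ▸ ENNReal.mul_ne_top (ENNReal.inv_ne_top.2 h30) hfin), hI,
      lintegral_rpow_eq_lintegral_meas_lt hS hm hfin, hJ,
      lintegral_rpow_eq_lintegral_meas_lt hW hm hWfin, mul_left_comm, ← mul_add,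
      ← lintegral_const_mul _ (hg S), ← lintegral_add_right _ (hg W)]
    refine mul_le_mul_right (setLIntegral_mono' measurableSet_Ioi fun l hl => ?_) _
    rw [← mul_assoc, ← add_mul]
    refine mul_le_mul_left ?_ _
    refine le_trans ?_ (add_le_add_left (h l hl) _)
    refine le_trans (measure_mono fun ω hω => ?_) (measure_union_le _ _)
    have hω' : ENNReal.ofReal (3 * l) < S ω := by
      have hlt : ENNReal.ofReal l < S ω / 3 := hω
      have := (ENNReal.lt_div_iff_mul_lt (by simp) (by simp)).1 hlt
      rwa [mul_comm, ENNReal.ofReal_mul (le_of_lt hl), ENNReal.ofReal_ofNat]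
    rcases le_or_gt (W ω) (ENNReal.ofReal l) with hw | hw
    · exact Or.inl ⟨hω', hw⟩
    · exact Or.inr hw
  have key2 : I ≤ 3 ^ m * c * I + 3 ^ m * J := by
    calc I = 3 ^ m * ((3 ^ m)⁻¹ * I) := by
          rw [← mul_assoc, ENNReal.mul_inv_cancel h30 h3t, one_mul]
      _ ≤ 3 ^ m * (c * I + J) := mul_le_mul_right key _
      _ = _ := by ring
  have key3 : I + I ≤ I + 2 * 3 ^ m * J := by
    calc I + I = 2 * I := by ring
      _ ≤ 2 * (3 ^ m * c * I + 3 ^ m * J) := mul_le_mul_right key2 _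
      _ = 2 * (3 ^ m * c) * I + 2 * 3 ^ m * J := by ring
      _ ≤ 1 * I + 2 * 3 ^ m * J := by gcongr
      _ = _ := by rw [one_mul]
  exact (ENNReal.add_le_add_iff_left hfin).1 key3

/-! ### From `Fin`-indexed to `ℕ`-indexed sequences -/

/-- The filtration `G 0 ⊆ … ⊆ G N` continued by `G N` at all later times. -/
def Fin.extendFiltration {Ω : Type*} {mΩ : MeasurableSpace Ω} {N : ℕ}
    (G : Filtration (Fin (N + 1)) mΩ) : Filtration ℕ mΩ where
  seq n := G ⟨min n N, Nat.lt_succ_of_le (min_le_right n N)⟩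
  mono' _ _ h := G.mono (min_le_min_right N h)
  le' _ := G.le _

/-- The sequence `ξ 0, …, ξ (N - 1)` continued by zeros. -/
def Fin.extendByZero {Ω : Type*} {N p : ℕ} (ξ : Fin N → Ω → Fin p → ℝ) (i : ℕ) (ω : Ω)
    (j : Fin p) : ℝ :=
  if h : i < N then ξ ⟨i, h⟩ ω j else 0

theorem Fin.extendFiltration_castSucc {Ω : Type*} {mΩ : MeasurableSpace Ω} {N : ℕ}
    (G : Filtration (Fin (N + 1)) mΩ) (i : Fin N) :
    Fin.extendFiltration G i = G i.castSucc := by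
  change G _ = G _
  congr 1
  exact Fin.ext (min_eq_left i.2.le)

theorem Fin.extendFiltration_succ {Ω : Type*} {mΩ : MeasurableSpace Ω} {N : ℕ}
    (G : Filtration (Fin (N + 1)) mΩ) (i : Fin N) :
    Fin.extendFiltration G (i + 1) = G i.succ := by
  change G _ = G _
  congr 1
  exact Fin.ext (min_eq_left i.2)

theorem Fin.extendByZero_val {Ω : Type*} {N p : ℕ} (ξ : Fin N → Ω → Fin p → ℝ) (i : Fin N) :
    Fin.extendByZero ξ i = ξ i := by
  funext ω j
  simp [Fin.extendByZero]

theorem Fin.extendByZero_of_le {Ω : Type*} {N p : ℕ} (ξ : Fin N → Ω → Fin p → ℝ) {i : ℕ}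
    (hi : N ≤ i) : Fin.extendByZero ξ i = 0 := by
  funext ω j
  simp [Fin.extendByZero, hi.not_gt]

namespace IsMartingaleDifferenceSeq

variable {Ω : Type*} {mΩ : MeasurableSpace Ω} {μ : Measure Ω} {N p : ℕ}
  {G : Filtration (Fin (N + 1)) mΩ} {ξ : Fin N → Ω → Fin p → ℝ}

theorem measurable_apply (h : IsMartingaleDifferenceSeq ξ G μ) (i : Fin N) (j : Fin p) :
    Measurable[G i.succ] fun ω => ξ i ω j :=
  (measurable_pi_apply j).comp (h.adapted i).measurable

theorem integrable_apply (h : IsMartingaleDifferenceSeq ξ G μ) (i : Fin N) (j : Fin p) :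
    Integrable (fun ω => ξ i ω j) μ :=
  (ContinuousLinearMap.proj (R := ℝ) (φ := fun _ : Fin p => ℝ) j).integrable_comp (h.integrable i)

theorem condExp_apply (h : IsMartingaleDifferenceSeq ξ G μ) (i : Fin N) (j : Fin p) :
    μ[fun ω => ξ i ω j | G i.castSucc] =ᵐ[μ] 0 := by
  have h1 := (ContinuousLinearMap.proj (R := ℝ) (φ := fun _ : Fin p => ℝ) j).comp_condExp_comm
    (m := G i.castSucc) (h.integrable i)
  filter_upwards [h1, h.condExp_eq_zero i] with ω hω hω0
  refine hω.symm.trans ?_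
  simp [hω0]

theorem measurable_extend (h : IsMartingaleDifferenceSeq ξ G μ) (i : ℕ) (j : Fin p) :
    Measurable[Fin.extendFiltration G (i + 1)] fun ω => Fin.extendByZero ξ i ω j := by
  rcases lt_or_ge i N with hi | hi
  · lift i to Fin N using hi
    rw [Fin.extendFiltration_succ, Fin.extendByZero_val]
    exact h.measurable_apply i j
  · rw [Fin.extendByZero_of_le ξ hi]
    exact measurable_const

theorem integrable_extend (h : IsMartingaleDifferenceSeq ξ G μ) (i : ℕ) (j : Fin p) :
    Integrable (fun ω => Fin.extendByZero ξ i ω j) μ := by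
  rcases lt_or_ge i N with hi | hi
  · lift i to Fin N using hi
    rw [Fin.extendByZero_val]
    exact h.integrable_apply i j
  · rw [Fin.extendByZero_of_le ξ hi]
    exact integrable_zero _ _ _

theorem condExp_extend (h : IsMartingaleDifferenceSeq ξ G μ) (i : ℕ) (j : Fin p) :
    μ[fun ω => Fin.extendByZero ξ i ω j | Fin.extendFiltration G i] =ᵐ[μ] 0 := by
  rcases lt_or_ge i N with hi | hi
  · lift i to Fin N using hi
    rw [Fin.extendByZero_val, Fin.extendFiltration_castSucc]
    exact h.condExp_apply i j
  · rw [Fin.extendByZero_of_le ξ hi]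
    exact (condExp_zero (μ := μ) (E := ℝ)).eventuallyEq

theorem measurable_maxPartialSum (h : IsMartingaleDifferenceSeq ξ G μ) :
    Measurable (maxPartialSum ξ) := by
  refine Measurable.iSup fun j => Measurable.iSup fun n => Measurable.ennreal_ofReal ?_
  have hsum : Measurable fun ω => ∑ i ∈ Finset.Iic n, ξ i ω j :=
    Finset.measurable_fun_sum _ fun i _ => (h.measurable_apply i j).mono (G.le _) le_rfl
  exact measurable_norm.comp hsum

theorem measurable_maxIncrement (h : IsMartingaleDifferenceSeq ξ G μ) :
    Measurable (maxIncrement ξ) :=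
  Measurable.iSup fun i => Measurable.iSup fun j => Measurable.ennreal_ofReal
    (measurable_norm.comp ((h.measurable_apply i j).mono (G.le _) le_rfl))

end IsMartingaleDifferenceSeq

theorem measurable_maxCondSD {Ω : Type*} {mΩ : MeasurableSpace Ω} {N p : ℕ}
    (ξ : Fin N → Ω → Fin p → ℝ) (G : Filtration (Fin (N + 1)) mΩ) (μ : Measure Ω) :
    Measurable (maxCondSD ξ G μ) :=
  Measurable.iSup fun _ => (Finset.measurable_fun_sum _ fun _ _ =>
    measurable_condLExp' _ _ _).pow_const _

theorem sum_Iic_eq_sum_range_extendByZero {Ω : Type*} {N p : ℕ} (ξ : Fin N → Ω → Fin p → ℝ)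
    (n : Fin N) (ω : Ω) (j : Fin p) :
    ∑ i ∈ Finset.Iic n, ξ i ω j = ∑ i ∈ Finset.range (n + 1), Fin.extendByZero ξ i ω j := by
  have : Finset.range (n + 1) = (Finset.Iic n).map Fin.valEmbedding := by
    rw [Fin.map_valEmbedding_Iic]
    ext k
    simp
  rw [this, Finset.sum_map]
  simp [Fin.extendByZero_val]

theorem ofReal_lt_maxPartialSum_iff {Ω : Type*} {N p : ℕ} (ξ : Fin N → Ω → Fin p → ℝ) {l : ℝ}
    (hl : 0 ≤ l) (ω : Ω) :
    ENNReal.ofReal l < maxPartialSum ξ ω ↔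
      ∃ n ≤ N, ∃ j, l < |∑ i ∈ Finset.range n, Fin.extendByZero ξ i ω j| := by
  simp only [maxPartialSum, lt_iSup_iff, ENNReal.ofReal_lt_ofReal_iff_of_nonneg hl,
    sum_Iic_eq_sum_range_extendByZero]
  constructor
  · rintro ⟨j, n, h⟩
    exact ⟨n + 1, n.2, j, h⟩
  · rintro ⟨n, hn, j, h⟩
    cases n with
    | zero => exact absurd h (by simpa using hl)
    | succ n => exact ⟨j, ⟨n, hn⟩, h⟩

theorem abs_extendByZero_le_of_maxIncrement_le {Ω : Type*} {N p : ℕ} {ξ : Fin N → Ω → Fin p → ℝ}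
    {b : ℝ} (hb : 0 ≤ b) {ω : Ω} (h : maxIncrement ξ ω ≤ ENNReal.ofReal b) (i : ℕ) (j : Fin p) :
    |Fin.extendByZero ξ i ω j| ≤ b := by
  rcases lt_or_ge i N with hi | hi
  · lift i to Fin N using hi
    rw [Fin.extendByZero_val]
    rw [← ENNReal.ofReal_le_ofReal_iff hb]
    exact (le_iSup_of_le i (le_iSup (fun j => ENNReal.ofReal |ξ i ω j|) j)).trans h
  · simpa [Fin.extendByZero_of_le ξ hi] using hb

theorem sum_condLExp_le_of_maxCondSD_le {Ω : Type*} {mΩ : MeasurableSpace Ω} {N p : ℕ}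
    {ξ : Fin N → Ω → Fin p → ℝ} {G : Filtration (Fin (N + 1)) mΩ} {μ : Measure Ω} {v : ℝ}
    (hv : 0 ≤ v) {ω : Ω} (h : maxCondSD ξ G μ ω ≤ ENNReal.ofReal v) (j : Fin p) :
    ∑ i ∈ Finset.range N, condLExp (Fin.extendFiltration G i) μ
      (fun ω' => ENNReal.ofReal (Fin.extendByZero ξ i ω' j ^ 2)) ω ≤ ENNReal.ofReal (v ^ 2) := by
  rw [← Fin.sum_univ_eq_sum_range (fun i => condLExp (Fin.extendFiltration G i) μ
      (fun ω' => ENNReal.ofReal (Fin.extendByZero ξ i ω' j ^ 2)) ω)]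
  simp only [Fin.extendByZero_val, Fin.extendFiltration_castSucc]
  have hj := (le_iSup_of_le j le_rfl : _ ≤ maxCondSD ξ G μ ω).trans h
  rw [one_div, ENNReal.rpow_inv_le_iff (by norm_num),
    ENNReal.ofReal_rpow_of_nonneg hv (by norm_num)] at hj
  simpa using hj

/-- A crude bound, used only to transfer integrability. -/
theorem maxPartialSum_le_mul_maxIncrement {Ω : Type*} {N p : ℕ} (ξ : Fin N → Ω → Fin p → ℝ)
    (ω : Ω) : maxPartialSum ξ ω ≤ N * maxIncrement ξ ω := by
  refine iSup_le fun j => iSup_le fun n => ?_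
  calc ENNReal.ofReal |∑ i ∈ Finset.Iic n, ξ i ω j|
      ≤ ENNReal.ofReal (∑ i ∈ Finset.Iic n, |ξ i ω j|) :=
        ENNReal.ofReal_le_ofReal (Finset.abs_sum_le_sum_abs _ _)
    _ = ∑ i ∈ Finset.Iic n, ENNReal.ofReal |ξ i ω j| :=
        ENNReal.ofReal_sum_of_nonneg fun _ _ => abs_nonneg _
    _ ≤ ∑ i : Fin N, ENNReal.ofReal |ξ i ω j| := Finset.sum_le_sum_of_subset (Finset.subset_univ _)
    _ ≤ ∑ _i : Fin N, maxIncrement ξ ω :=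
        Finset.sum_le_sum fun i _ => le_iSup_of_le i (le_iSup_of_le j le_rfl)
    _ = N * maxIncrement ξ ω := by simp

/-! ### The moment bound -/

theorem eLpNorm_ofReal_eq_lintegral {Ω : Type*} {mΩ : MeasurableSpace Ω} {μ : Measure Ω}
    (f : Ω → ℝ≥0∞) {m : ℝ} (hm : 0 < m) :
    eLpNorm f (ENNReal.ofReal m) μ = (∫⁻ ω, f ω ^ m ∂μ) ^ (1 / m) := by
  rw [eLpNorm_eq_lintegral_rpow_enorm_toReal (by simpa using hm) ENNReal.ofReal_ne_top,
    ENNReal.toReal_ofReal hm.le]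
  simp

/-- Here `2 * 2 ≤ exp (2 M)`, `3 ^ m ≤ exp (2 M)` and `p ≤ exp M`, where `M = m + log p`. -/
theorem goodLambda_const_le {m : ℝ} {p : ℕ} (hm : 1 ≤ m) (hp : 1 ≤ p) :
    2 * ((3 : ℝ≥0∞) ^ m * (2 * p * ENNReal.ofReal (Real.exp (-5 * (m + Real.log p))))) ≤ 1 := by
  have hp1 : (1 : ℝ) ≤ p := by exact_mod_cast hp
  set M := m + Real.log p with hM
  have hlog : 0 ≤ Real.log p := Real.log_nonneg hp1
  have h2 : (2 : ℝ) ≤ Real.exp M := by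
    have := Real.add_one_le_exp M
    linarith
  have h3 : (3 : ℝ) ^ m ≤ Real.exp (2 * M) := by
    rw [Real.rpow_def_of_pos (by norm_num), Real.exp_le_exp]
    have : Real.log 3 ≤ 3 - 1 := Real.log_le_sub_one_of_pos (by norm_num)
    nlinarith
  have h4 : (p : ℝ) ≤ Real.exp M := by
    rw [← Real.log_le_iff_le_exp (by linarith)]
    linarith
  have key : 2 * ((3 : ℝ) ^ m * (2 * p * Real.exp (-5 * M))) ≤ 1 := by
    calc 2 * ((3 : ℝ) ^ m * (2 * p * Real.exp (-5 * M)))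
        ≤ Real.exp M * (Real.exp (2 * M) * (Real.exp M * Real.exp M * Real.exp (-5 * M))) := by
          gcongr
      _ = 1 := by
          rw [← Real.exp_add, ← Real.exp_add, ← Real.exp_add, ← Real.exp_add, Real.exp_eq_one_iff]
          ring
  have hcast : 2 * ((3 : ℝ≥0∞) ^ m * (2 * p * ENNReal.ofReal (Real.exp (-5 * M)))) =
      ENNReal.ofReal (2 * ((3 : ℝ) ^ m * (2 * p * Real.exp (-5 * M)))) := by
    rw [ENNReal.ofReal_mul (by norm_num), ENNReal.ofReal_mul (by positivity),
      ENNReal.ofReal_mul (by positivity), ENNReal.ofReal_mul (by norm_num),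
      ← ENNReal.ofReal_rpow_of_pos (by norm_num)]
    simp
  rw [hcast]
  exact ENNReal.ofReal_le_one.2 key

theorem mainTheorem7 :
    ∃ C : ℝ, 0 < C ∧
      ∀ (Ω : Type*) (mΩ : MeasurableSpace Ω) (μ : Measure Ω) (_ : IsProbabilityMeasure μ)
        (N p : ℕ) (_ : 1 ≤ p) (G : Filtration (Fin (N + 1)) mΩ)
        (ξ : Fin N → Ω → Fin p → ℝ) (_ : IsMartingaleDifferenceSeq ξ G μ)
        (m : ℝ) (_ : 1 ≤ m),
        eLpNorm (maxPartialSum ξ) (ENNReal.ofReal m) μ ≤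
          ENNReal.ofReal C *
            (eLpNorm (maxCondSD ξ G μ) (ENNReal.ofReal m) μ *
                ENNReal.ofReal (Real.sqrt (m + Real.log p)) +
              eLpNorm (maxIncrement ξ) (ENNReal.ofReal m) μ *
                ENNReal.ofReal (m + Real.log p)) := by
  refine ⟨36, by norm_num, ?_⟩
  intro Ω mΩ μ _ N p hp G ξ hξ m hm
  have hm0 : 0 < m := by linarith
  have hp1 : (1 : ℝ) ≤ p := by exact_mod_cast hp
  set M := m + Real.log p with hM
  have hM1 : 1 ≤ M := by linarith [Real.log_nonneg hp1]
  have hM0 : 0 < M := by linarith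
  set V := maxCondSD ξ G μ with hV
  set B := maxIncrement ξ with hB
  set S := maxPartialSum ξ with hS
  have hVm : Measurable V := measurable_maxCondSD ξ G μ
  have hBm : Measurable B := hξ.measurable_maxIncrement
  have hSm : Measurable S := hξ.measurable_maxPartialSum
  by_cases hBtop : eLpNorm B (ENNReal.ofReal m) μ = ∞
  · have : ENNReal.ofReal M ≠ 0 := by simpa using hM0
    simp [hBtop, ENNReal.top_mul this]
  have hSfin : ∫⁻ ω, S ω ^ m ∂μ ≠ ∞ := by
    have hBfin : ∫⁻ ω, B ω ^ m ∂μ ≠ ∞ := by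
      intro h
      rw [eLpNorm_ofReal_eq_lintegral B hm0, h] at hBtop
      exact hBtop (ENNReal.top_rpow_of_pos (by positivity))
    refine ne_top_of_le_ne_top ?_ (lintegral_mono fun ω =>
      ENNReal.rpow_le_rpow (maxPartialSum_le_mul_maxIncrement ξ ω) hm0.le)
    simp_rw [ENNReal.mul_rpow_of_nonneg _ _ hm0.le]
    rw [lintegral_const_mul _ (hBm.pow_const m)]
    exact ENNReal.mul_ne_top (ENNReal.rpow_ne_top_of_nonneg hm0.le (by simp)) hBfin
  set W : Ω → ℝ≥0∞ := (fun ω => ENNReal.ofReal (6 * √M) * V ω) +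
    fun ω => ENNReal.ofReal (6 * M) * B ω with hW
  have hWm : Measurable W := (hVm.const_mul _).add (hBm.const_mul _)
  have hsq : 0 < √M := Real.sqrt_pos.2 hM0
  have hdiv : ∀ {a l : ℝ} {x : ℝ≥0∞}, 0 < a → ENNReal.ofReal a * x ≤ ENNReal.ofReal l →
      x ≤ ENNReal.ofReal (l / a) := by
    intro a l x ha h
    rw [ENNReal.ofReal_div_of_pos ha,
      ENNReal.le_div_iff_mul_le (Or.inl (by simpa using ha)) (Or.inl ENNReal.ofReal_ne_top),
      mul_comm]
    exact h
  have hmain := lintegral_rpow_le_of_goodLambda hSm hWm hm0 (goodLambda_const_le hm hp) hSfin (by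
    intro l hl
    -- With `b = l / (6 M)`, `t = 1 / b` and `v² = l² / (36 M)` the exponent is `-6 M + M`.
    have h := measure_goodLambda_le (μ := μ) hξ.measurable_extend hξ.integrable_extend
      hξ.condExp_extend (t := 6 * M / l) (b := l / (6 * M)) (l := l) (r := (l / (6 * √M)) ^ 2)
      (by positivity) (le_of_eq (by field_simp)) (by positivity)
      (div_le_self hl.le (by linarith)) (by positivity) N
    have hexp : -(6 * M / l) * l + (6 * M / l) ^ 2 * (l / (6 * √M)) ^ 2 = -5 * M := by
      rw [div_pow l, mul_pow 6 √M, Real.sq_sqrt hM0.le]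
      field_simp
      ring
    rw [hexp] at h
    have hset : {ω | ENNReal.ofReal l < S ω} =
        {ω | ∃ n ≤ N, ∃ j, l < |∑ i ∈ Finset.range n, Fin.extendByZero ξ i ω j|} :=
      Set.ext fun ω => ofReal_lt_maxPartialSum_iff ξ hl.le ω
    rw [hset]
    refine le_trans (measure_mono ?_) h
    rintro ω ⟨hω, hWω⟩
    have hVω : V ω ≤ ENNReal.ofReal (l / (6 * √M)) :=
      hdiv (by positivity) (le_self_add.trans hWω)
    have hBω : B ω ≤ ENNReal.ofReal (l / (6 * M)) :=
      hdiv (by positivity) (le_add_self.trans hWω)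
    exact ⟨(ofReal_lt_maxPartialSum_iff ξ (by positivity) ω).1 hω,
      fun i _ j => abs_extendByZero_le_of_maxIncrement_le (by positivity) hBω i j,
      fun j => sum_condLExp_le_of_maxCondSD_le (by positivity) hVω j⟩)
  have hSW : eLpNorm S (ENNReal.ofReal m) μ ≤ 6 * eLpNorm W (ENNReal.ofReal m) μ := by
    rw [eLpNorm_ofReal_eq_lintegral S hm0, eLpNorm_ofReal_eq_lintegral W hm0,
      one_div, ENNReal.rpow_inv_le_iff hm0, ENNReal.mul_rpow_of_nonneg _ _ hm0.le,
      ← ENNReal.rpow_mul, inv_mul_cancel₀ hm0.ne', ENNReal.rpow_one]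
    refine hmain.trans (mul_le_mul_left ?_ _)
    calc (2 : ℝ≥0∞) * 3 ^ m ≤ 2 ^ m * 3 ^ m :=
          mul_le_mul_left (ENNReal.le_rpow_self_of_one_le (by norm_num) hm) _
      _ = 6 ^ m := by
          rw [← ENNReal.mul_rpow_of_nonneg _ _ hm0.le]
          norm_num
  have hconst : ∀ (a : ℝ) (f : Ω → ℝ≥0∞),
      eLpNorm (fun ω => ENNReal.ofReal a * f ω) (ENNReal.ofReal m) μ ≤
        ENNReal.ofReal a * eLpNorm f (ENNReal.ofReal m) μ := fun a f =>
    eLpNorm_le_nnreal_smul_eLpNorm_of_ae_le_mul' (c := a.toNNReal) (ae_of_all _ fun _ => le_rfl) _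
  have hm1 : 1 ≤ ENNReal.ofReal m := by simpa using hm
  calc eLpNorm S (ENNReal.ofReal m) μ
      ≤ 6 * eLpNorm W (ENNReal.ofReal m) μ := hSW
    _ ≤ 6 * (ENNReal.ofReal (6 * √M) * eLpNorm V (ENNReal.ofReal m) μ +
          ENNReal.ofReal (6 * M) * eLpNorm B (ENNReal.ofReal m) μ) := by
        refine mul_le_mul_right ((eLpNorm_add_le (hVm.const_mul _).aestronglyMeasurable
          (hBm.const_mul _).aestronglyMeasurable hm1).trans ?_) _
        exact add_le_add (hconst _ V) (hconst _ B)
    _ = ENNReal.ofReal 36 * (eLpNorm V (ENNReal.ofReal m) μ * ENNReal.ofReal √M +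
          eLpNorm B (ENNReal.ofReal m) μ * ENNReal.ofReal M) := by
        rw [ENNReal.ofReal_mul (by norm_num), ENNReal.ofReal_mul (by norm_num),
          show (36 : ℝ) = 6 * 6 by norm_num, ENNReal.ofReal_mul (by norm_num), ENNReal.ofReal_ofNat]
        ring
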